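/- \textbf{Theorem.} Consider structured (goto-free) programs, built from simple statements (possibly empty) by sequential composition, branching (if-then-else or multiway selection), loops (while, for, foreach, do-while, unconditional), switch with fall-through, and the jumps \texttt{break} (leaves the nearest enclosing loop or switch), \texttt{continue} (goes to the next iteration of the nearest enclosing loop) and \texttt{return} (goes to \texttt{stop}). The control-flow graph of a program is the finite digraph with a vertex \texttt{start}, a sink \texttt{stop}, and one vertex for each simple statement, each branching or switch test, and each loop (its head, or its final test in the case of do-while); its edges $(u,v)$ are the possible direct transfers of control from $u$ to $v$. Empty statements and jumps have no vertex of their own: they pass control directly to their target (a jump that is to have its own vertex is written as a simple statement followed by the jump). A DAG decomposition of a digraph $G=(V,E)$ is a finite directed acyclic graph $D$ with a bag $X_i\subseteq V$ for each node $i$ of $D$ such that, writing $i\preceq_D j$ if $D$ has a directed path (possibly of length $0$) from $i$ to $j$: (1) $\bigcup_i X_i=V$; (2) if $i\preceq_D k\preceq_D j$, then $X_i\cap X_j\subseteq X_k$; (3a) for every source $j$ of $D$, every $u\in X_j$ and every $(u,v)\in E$ there is $k$ with $j\preceq_D k$ and $v\in X_k$; (3b) for every arc $(i,j)$ of $D$,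 every $u\in X_j\setminus X_i$ and every $(u,v)\in E$ there is $k$ with $j\preceq_D k$ and $v\in X_k$. Its width is $\max_i|X_i|$, and the DAG-width of $G$ is the least width of a DAG decomposition of $G$. Then the control-flow graph of every structured program has DAG-width at most $3$, and this bound is tight: there is a structured program whose control-flow graph has DAG-width at least $3$. -/

import Mathlib

/-! ## Structured (goto-free) programs -/

/-- Abstract syntax of structured programs. -/
inductive Stmt : Type
  /-- The empty statement: it has no vertex of its own. -/
  | empty : Stmt
  /-- A simple statement (or basic block): one vertex, left towards the next statement. -/
  | basic : Stmt
  /-- Sequential composition `s; t`. -/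
  | seq (s t : Stmt) : Stmt
  /-- A branching: one vertex (the test) and one edge to each of the `n + 1 ≥ 1` alternatives.
  Two alternatives give `if-then-else` (`if-then` when the second one is `empty`); more give a
  multiway selection without fall-through. -/
  | branch (n : ℕ) (alt : Fin (n + 1) → Stmt) : Stmt
  /-- A loop that is entered through its head `h`. The head leads to `body`, and also to the exit
  point if `test` holds; `body` is followed by `step` and `step` by the head. `continue` in `body`
  leads to `step`. With `step = empty` this is `while` / `foreach` (`test = true`) or an
  unconditional loop (`test = false`); with nonempty `step` it is a `for` loop. -/
  | loop (test : Bool) (body step : Stmt) : Stmt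
  /-- `do body while (q)`: the vertex is the test `q`, evaluated after `body`; `continue` in `body`
  leads to `q`. -/
  | doWhile (body : Stmt) : Stmt
  /-- `switch` with fall-through: one vertex with an edge to every `caseLabel` of `body`, and also
  to the succeeding statement if there is no default label. `break` in `body` leaves the switch. -/
  | switch (hasDefault : Bool) (body : Stmt) : Stmt
  /-- The statement `s` carrying a label of the enclosing `switch`. -/
  | caseLabel (s : Stmt) : Stmt
  /-- `break`. The three jump statements have no vertex of their own: control is passed to the
  target of the jump directly. A jump with its own vertex is `seq basic` of that jump. -/
  | brk : Stmt
  /-- `continue`. -/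
  | cont : Stmt
  /-- `return` (or program exit). -/
  | ret : Stmt

/-- Where control may be passed from within a statement: to a vertex of the statement, or to one
of the four symbolic successors: the succeeding statement (`out`), the `break` target (`exit`), the
`continue` target (`entry`), the end of the program (`halt`). -/
inductive Target (α : Type) : Type
  | vertex (a : α) : Target α
  | out : Target α
  | exit : Target α
  | entry : Target α
  | halt : Target α

/-- Embed the vertices by `f` and resolve `out`, `exit`, `entry` to `o`, `x`, `e`. -/
def Target.resolve {α β : Type} (f : α → β) (o x e : Target β) : Target α → Target β
  | .vertex a => .vertex (f a)
  | .out => o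
  | .exit => x
  | .entry => e
  | .halt => .halt

namespace Stmt

/-- The vertices of a statement. -/
def Vertex : Stmt → Type
  | .empty => Empty
  | .basic => Unit
  | .seq s t => s.Vertex ⊕ t.Vertex
  | .branch n alt => Option (Σ i : Fin (n + 1), (alt i).Vertex)
  | .loop _ body step => Option (body.Vertex ⊕ step.Vertex)
  | .doWhile body => Option body.Vertex
  | .switch _ body => Option body.Vertex
  | .caseLabel s => s.Vertex
  | .brk => Empty
  | .cont => Empty
  | .ret => Empty

/-- Where control is passed when the statement is entered. -/
def first : (s : Stmt) → Target s.Vertex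
  | .empty => .out
  | .basic => .vertex ()
  | .seq s t =>
      Target.resolve Sum.inl (Target.resolve Sum.inr .out .exit .entry t.first) .exit .entry
        s.first
  | .branch _ _ => .vertex none
  | .loop _ _ _ => .vertex none
  | .doWhile body => Target.resolve some (.vertex none) .out (.vertex none) body.first
  | .switch _ _ => .vertex none
  | .caseLabel s => s.first
  | .brk => .exit
  | .cont => .entry
  | .ret => .halt

/-- The vertices and exits of `s`, seen from the sequence `s; t`. -/
def seqLeft (s t : Stmt) : Target s.Vertex → Target (s.seq t).Vertex :=
  Target.resolve Sum.inl (Target.resolve Sum.inr .out .exit .entry t.first) .exit .entry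

/-- The vertices and exits of `t`, seen from the sequence `s; t`. -/
def seqRight (s t : Stmt) : Target t.Vertex → Target (s.seq t).Vertex :=
  Target.resolve Sum.inr .out .exit .entry

/-- The vertices and exits of the `i`-th alternative, seen from the branching. -/
def inBranch (n : ℕ) (alt : Fin (n + 1) → Stmt) (i : Fin (n + 1)) :
    Target (alt i).Vertex → Target (Stmt.branch n alt).Vertex :=
  Target.resolve (fun a => some ⟨i, a⟩) .out .exit .entry

/-- The vertices and exits of `step`, seen from the loop. -/
def inLoopStep (test : Bool) (body step : Stmt) :
    Target step.Vertex → Target (Stmt.loop test body step).Vertex :=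
  Target.resolve (fun b => some (.inr b)) (.vertex none) .out (.vertex none)

/-- The vertices and exits of `body`, seen from the loop: both the end of `body` and its
`continue` lead to `step`. -/
def inLoopBody (test : Bool) (body step : Stmt) :
    Target body.Vertex → Target (Stmt.loop test body step).Vertex :=
  Target.resolve (fun a => some (.inl a)) (inLoopStep test body step step.first) .out
    (inLoopStep test body step step.first)

/-- The vertices and exits of `body`, seen from the `do-while` loop. -/
def inDoWhile (body : Stmt) : Target body.Vertex → Target (Stmt.doWhile body).Vertex :=
  Target.resolve some (.vertex none) .out (.vertex none)

/-- The vertices and exits of `body`, seen from the `switch`. -/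
def inSwitch (hasDefault : Bool) (body : Stmt) :
    Target body.Vertex → Target (Stmt.switch hasDefault body).Vertex :=
  Target.resolve some .out .out .entry

/-- Where a `switch` whose body is the given statement can pass control to: the statements that
carry a label. -/
def labels : (s : Stmt) → Set (Target s.Vertex)
  | .seq s t => seqLeft s t '' s.labels ∪ seqRight s t '' t.labels
  | .caseLabel s => insert s.first s.labels
  | _ => ∅

/-- The potential successors of each vertex of a statement. -/
def succs : (s : Stmt) → s.Vertex → Set (Target s.Vertex)
  | .basic, _ => {.out}
  | .seq s t, .inl a => seqLeft s t '' s.succs a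
  | .seq s t, .inr b => seqRight s t '' t.succs b
  | .branch n alt, none => {τ | ∃ i, τ = inBranch n alt i (alt i).first}
  | .branch n alt, some ⟨i, a⟩ => inBranch n alt i '' (alt i).succs a
  | .loop test body step, none =>
      {τ | τ = inLoopBody test body step body.first ∨ (test = true ∧ τ = .out)}
  | .loop test body step, some (.inl a) => inLoopBody test body step '' body.succs a
  | .loop test body step, some (.inr b) => inLoopStep test body step '' step.succs b
  | .doWhile body, none => {τ | τ = inDoWhile body body.first ∨ τ = .out}
  | .doWhile body, some a => inDoWhile body '' body.succs a
  | .switch hasDefault body, none =>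
      {τ | τ ∈ inSwitch hasDefault body '' body.labels ∨ (hasDefault = false ∧ τ = .out)}
  | .switch hasDefault body, some a => inSwitch hasDefault body '' body.succs a
  | .caseLabel s, a => s.succs a

end Stmt

/-! ## Control-flow graphs -/

/-- Vertices of the control-flow graph of the program `p`. -/
inductive CfgVertex (p : Stmt) : Type
  | start : CfgVertex p
  | node (a : p.Vertex) : CfgVertex p
  | halt : CfgVertex p

/-- At the top level, whatever leaves the program leads to `halt`. -/
def CfgVertex.ofTarget {p : Stmt} : Target p.Vertex → CfgVertex p
  | .vertex a => .node a
  | .out => .halt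
  | .exit => .halt
  | .entry => .halt
  | .halt => .halt

/-- The control-flow graph of the structured program `p`. -/
def controlFlowGraph (p : Stmt) : Digraph (CfgVertex p) where
  Adj u v :=
    match u with
    | .start => v = CfgVertex.ofTarget p.first
    | .node a => ∃ τ ∈ p.succs a, v = CfgVertex.ofTarget τ
    | .halt => False

/-! ## DAG-width -/

/-- A DAG decomposition of a digraph `G`: a finite directed acyclic graph whose nodes carry bags
of vertices of `G`. -/
structure DagDecomposition {V : Type*} (G : Digraph V) where
  /-- The nodes of the DAG. -/
  Node : Type
  finite : Finite Node
  /-- The arcs of the DAG. -/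
  dag : Digraph Node
  acyclic : ∀ i, ¬ Relation.TransGen dag.Adj i i
  /-- The bag of a node. -/
  bag : Node → Set V
  covers : ∀ v, ∃ i, v ∈ bag i
  connected : ∀ i k j, Relation.ReflTransGen dag.Adj i k → Relation.ReflTransGen dag.Adj k j →
    bag i ∩ bag j ⊆ bag k
  source_edges : ∀ j, (∀ i, ¬ dag.Adj i j) → ∀ u ∈ bag j, ∀ v, G.Adj u v →
    ∃ k, Relation.ReflTransGen dag.Adj j k ∧ v ∈ bag k
  arc_edges : ∀ i j, dag.Adj i j → ∀ u ∈ bag j \ bag i, ∀ v, G.Adj u v →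
    ∃ k, Relation.ReflTransGen dag.Adj j k ∧ v ∈ bag k

/-- The width of a DAG decomposition: the largest size of a bag. -/
noncomputable def DagDecomposition.width {V : Type*} {G : Digraph V} (d : DagDecomposition G) :
    ℕ∞ :=
  ⨆ i : d.Node, (d.bag i).encard

/-- The DAG-width of a digraph: the least width of a DAG decomposition. -/
noncomputable def dagWidth {V : Type*} (G : Digraph V) : ℕ∞ :=
  ⨅ d : DagDecomposition G, d.width

/-! ## A cops-and-robber strategy with three cops -/

/-! The upper bound is a monotone strategy of three cops. Every cycle of a loop that is not inside a
nested loop passes through its head (or final test), and control leaves the loop only towards its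
exit point or the sink `z`. So two cops, on head and exit point, confine the robber to the inside,
where the third cop advances. If the robber is in a nested loop, the third cop guards the exit point
of that loop; it alone then cuts him off from the rest, and the outer two cops are free to be
reused.

`Safe` puts this into a form that composes, and `Stmt.safe_elim` proves it by induction on the
program: the statement's vertices are safe if its successors are. `Catch.dagWidth_le` turns the
strategy into a DAG decomposition.

For the lower bound, `three_le_dagWidth_of_evasion` follows a robber down a decomposition with bags
of at most two vertices. He always slips below a child of the present node without being in its bag,
which is impossible in a finite acyclic digraph. Such a robber exists on a loop that contains two
loops in sequence. -/

/-- `Catch G z X C`: three cops, at present on `X`, catch a robber in the territory `C` without ever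
returning to a vertex that they have left. The robber is lost as soon as he enters `z`. -/
inductive Catch {V : Type*} (G : Digraph V) (z : V) : Set V → Set V → Prop
  | drop {X Y C : Set V} : Y ⊆ X → Catch G z Y C → Catch G z X C
  | split {X : Set V} {n : ℕ} (C : Fin n → Set V) :
      (∀ i, Catch G z X (C i)) → Catch G z X (⋃ i, C i)
  | place {X C : Set V} (u : V) : u ∉ C → X.encard ≤ 2 →
      (∀ v, G.Adj u v → v = z ∨ v ∈ insert u (X ∪ C)) →
      Catch G z (insert u X) C → Catch G z X (insert u C)

/-- A rooted tree of bags that records a winning strategy of the cops: the bag of the root is `X`,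
and the vertices of `C` are introduced below the root. -/
structure CatchTree {V : Type*} (G : Digraph V) (z : V) (X C : Set V) where
  Node : Type
  finite : Finite Node
  arc : Node → Node → Prop
  root : Node
  bag : Node → Set V
  bag_root : bag root = X
  reach : ∀ j, Relation.ReflTransGen arc root j
  acyclic : ∀ i, ¬ Relation.TransGen arc i i
  bag_subset : ∀ j, bag j ⊆ X ∪ C
  covers : ∀ v ∈ C, ∃ j, v ∈ bag j
  connected : ∀ i k j, Relation.ReflTransGen arc i k → Relation.ReflTransGen arc k j →
    bag i ∩ bag j ⊆ bag k
  encard_le : ∀ j, (bag j).encard ≤ 3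
  arc_edges : ∀ i j, arc i j → ∀ u ∈ bag j \ bag i, ∀ v, G.Adj u v →
    v = z ∨ ∃ k, Relation.ReflTransGen arc j k ∧ v ∈ bag k

namespace CatchTree

variable {V : Type*} {G : Digraph V} {z : V}

/-- The arcs of the tree that joins the trees `T i` below a new root. -/
inductive JoinArc {ι : Type} {Y D : ι → Set V} (T : ∀ i, CatchTree G z (Y i) (D i)) :
    Option (Σ i, (T i).Node) → Option (Σ i, (T i).Node) → Prop
  | root (i : ι) : JoinArc T none (some ⟨i, (T i).root⟩)
  | inner (i : ι) (a b : (T i).Node) : (T i).arc a b → JoinArc T (some ⟨i, a⟩) (some ⟨i, b⟩)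

variable {ι : Type} {Y D : ι → Set V} (T : ∀ i, CatchTree G z (Y i) (D i))

theorem JoinArc.exists_of_reach {i : ι} {a : (T i).Node} {y : Option (Σ i, (T i).Node)}
    (h : Relation.ReflTransGen (JoinArc T) (some ⟨i, a⟩) y) :
    ∃ b, y = some ⟨i, b⟩ ∧ Relation.ReflTransGen (T i).arc a b := by
  induction h with
  | refl => exact ⟨a, rfl, .refl⟩
  | tail _ h ih =>
    obtain ⟨b, rfl, hb⟩ := ih
    cases h with
    | inner _ _ c hc => exact ⟨c, rfl, hb.tail hc⟩

theorem JoinArc.reach_inner {i : ι} {a b : (T i).Node} (h : Relation.ReflTransGen (T i).arc a b) :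
    Relation.ReflTransGen (JoinArc T) (some ⟨i, a⟩) (some ⟨i, b⟩) := by
  induction h with
  | refl => exact .refl
  | tail _ h ih => exact ih.tail (.inner _ _ _ h)

/-- Join the trees `T i` below a new root with bag `X`. -/
def join [Finite ι] {X C : Set V} (hX : X.encard ≤ 3) (hXC : Disjoint X C)
    (hY : ∀ i, Y i ⊆ X ∪ C) (hD : ∀ i, D i ⊆ C) (hC : ∀ v ∈ C, ∃ i, v ∈ Y i ∪ D i)
    (hadj : ∀ i, ∀ u ∈ Y i \ X, ∀ v, G.Adj u v → v = z ∨ v ∈ Y i ∪ D i) :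
    CatchTree G z X C :=
  let B : Option (Σ i, (T i).Node) → Set V := fun o => o.elim X fun p => (T p.1).bag p.2
  have hmem : ∀ i, ∀ v ∈ Y i ∪ D i, ∃ b, v ∈ (T i).bag b := by
    rintro i v (hv | hv)
    · exact ⟨(T i).root, by rwa [(T i).bag_root]⟩
    · exact (T i).covers v hv
  { Node := Option (Σ i, (T i).Node)
    finite := by
      have := fun i => (T i).finite
      infer_instance
    arc := JoinArc T
    root := none
    bag := B
    bag_root := rfl
    reach := by
      rintro (_ | ⟨i, b⟩)
      · exact .refl
      · exact .head (.root i) (JoinArc.reach_inner T ((T i).reach b))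
    acyclic := by
      intro x hx
      obtain ⟨y, hxy, hyx⟩ := Relation.TransGen.head'_iff.1 hx
      cases hxy with
      | root i =>
        obtain ⟨b, hb, -⟩ := JoinArc.exists_of_reach T hyx
        cases hb
      | inner i a b hab =>
        obtain ⟨c, hc, hbc⟩ := JoinArc.exists_of_reach T hyx
        obtain rfl : a = c := by simpa using hc
        exact (T i).acyclic a (Relation.TransGen.head' hab hbc)
    bag_subset := by
      rintro (_ | ⟨i, b⟩)
      · exact Set.subset_union_left
      · exact ((T i).bag_subset b).trans
          (Set.union_subset (hY i) ((hD i).trans Set.subset_union_right))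
    covers := by
      intro v hv
      obtain ⟨i, hi⟩ := hC v hv
      obtain ⟨b, hb⟩ := hmem i v hi
      exact ⟨some ⟨i, b⟩, hb⟩
    connected := by
      rintro (_ | ⟨i, a⟩) k j hik hkj
      · rcases k with _ | ⟨i, b⟩
        · exact Set.inter_subset_left
        -- A vertex of the new root that recurs below lies in `X`, hence not in `D i`; so it already
        -- lies in the bag `Y i` of the subtree's root, and connectedness inside the subtree
        -- applies.
        · obtain ⟨c, rfl, hbc⟩ := JoinArc.exists_of_reach T hkj
          rintro v ⟨hv, hvc⟩
          have hvY : v ∈ Y i := by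
            rcases (T i).bag_subset c hvc with h | h
            · exact h
            · exact absurd (hD i h) (Set.disjoint_left.1 hXC hv)
          exact (T i).connected _ b c ((T i).reach b) hbc ⟨by rwa [(T i).bag_root], hvc⟩
      · obtain ⟨b, rfl, hab⟩ := JoinArc.exists_of_reach T hik
        obtain ⟨c, rfl, hbc⟩ := JoinArc.exists_of_reach T hkj
        exact (T i).connected a b c hab hbc
    encard_le := by
      rintro (_ | ⟨i, b⟩)
      · exact hX
      · exact (T i).encard_le b
    arc_edges := by
      intro x y hxy u hu v huv
      cases hxy with
      | root i =>
        have hu' : u ∈ Y i \ X := ⟨by simpa [B, (T i).bag_root] using hu.1, hu.2⟩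
        refine (hadj i u hu' v huv).imp_right fun hv => ?_
        obtain ⟨b, hb⟩ := hmem i v hv
        exact ⟨some ⟨i, b⟩, JoinArc.reach_inner T ((T i).reach b), hb⟩
      | inner i a b hab =>
        refine ((T i).arc_edges a b hab u hu v huv).imp_right ?_
        rintro ⟨c, hbc, hc⟩
        exact ⟨some ⟨i, c⟩, JoinArc.reach_inner T hbc, hc⟩ }

end CatchTree

/-- Each rule of `Catch` is one `join`: a child with fewer cops, `n` children with the same cops, or
a child with one more cop. Disjointness of `X` and `C` expresses that no vertex is introduced twice
on a path. -/
theorem Catch.nonempty_catchTree {V : Type*} {G : Digraph V} {z : V} {X C : Set V}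
    (h : Catch G z X C) (hX : X.encard ≤ 3) (hXC : Disjoint X C) :
    Nonempty (CatchTree G z X C) := by
  induction h with
  | @drop X Y C hYX _ ih =>
    obtain ⟨T⟩ := ih ((Set.encard_le_encard hYX).trans hX) (hXC.mono_left hYX)
    exact ⟨CatchTree.join (fun _ : Unit => T) hX hXC (fun _ => hYX.trans Set.subset_union_left)
      (fun _ => subset_rfl) (fun v hv => ⟨(), .inr hv⟩) fun _ u hu => absurd (hYX hu.1) hu.2⟩
  | @split X n C _ ih =>
    have T := fun i => (ih i hX (hXC.mono_right (Set.subset_iUnion C i))).some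
    refine ⟨CatchTree.join T hX hXC (fun _ => Set.subset_union_left) (Set.subset_iUnion C)
      (fun v hv => ?_) fun _ u hu => absurd hu.1 hu.2⟩
    obtain ⟨i, hi⟩ := Set.mem_iUnion.1 hv
    exact ⟨i, .inr hi⟩
  | @place X C u huC hcard hadj _ ih =>
    obtain ⟨T⟩ := ih ((Set.encard_insert_le X u).trans (by
        calc X.encard + 1 ≤ 2 + 1 := by gcongr
          _ = 3 := by norm_num))
      (Set.disjoint_insert_left.2 ⟨huC, hXC.mono_right (Set.subset_insert u C)⟩)
    refine ⟨CatchTree.join (fun _ : Unit => T) hX hXC (fun _ => ?_)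
      (fun _ => Set.subset_insert u C) (fun v hv => ⟨(), ?_⟩) fun _ w hw v hwv => ?_⟩
    · rw [Set.union_insert]
      exact Set.insert_subset_insert Set.subset_union_left
    · rcases hv with rfl | hv
      · exact .inl (.inl rfl)
      · exact .inr hv
    · obtain rfl : w = u := hw.1.resolve_right hw.2
      simpa [Set.insert_union] using hadj v hwv

/-! ### From strategy trees to DAG decompositions -/

namespace CatchTree

variable {V : Type*} {G : Digraph V} {z : V}

/-- The arcs of a tree, together with an arc from each node to a new bottom. -/
inductive BottomArc {X C : Set V} (T : CatchTree G z X C) : Option T.Node → Option T.Node → Prop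
  | bottom (a : T.Node) : BottomArc T (some a) none
  | inner (a b : T.Node) : T.arc a b → BottomArc T (some a) (some b)

section

variable {X C : Set V} {T : CatchTree G z X C}

theorem BottomArc.not_none {y : Option T.Node} : ¬ BottomArc T none y := nofun

theorem BottomArc.eq_none_of_reach {y : Option T.Node}
    (h : Relation.ReflTransGen (BottomArc T) none y) : y = none := by
  rcases Relation.ReflTransGen.cases_head h with h | ⟨_, h, -⟩
  · exact h.symm
  · exact absurd h BottomArc.not_none

theorem BottomArc.reach_inner {a b : T.Node} (h : Relation.ReflTransGen T.arc a b) :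
    Relation.ReflTransGen (BottomArc T) (some a) (some b) := by
  induction h with
  | refl => exact .refl
  | tail _ h ih => exact ih.tail (.inner _ _ h)

theorem BottomArc.reach_of_some {x : Option T.Node} {b : T.Node}
    (h : Relation.ReflTransGen (BottomArc T) x (some b)) :
    ∃ a, x = some a ∧ Relation.ReflTransGen T.arc a b := by
  induction h using Relation.ReflTransGen.head_induction_on with
  | refl => exact ⟨b, rfl, .refl⟩
  | head h _ ih =>
    obtain ⟨c, rfl, hc⟩ := ih
    cases h with
    | inner a _ hac => exact ⟨a, rfl, hc.head hac⟩

end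

/-- A strategy that starts without cops gives a DAG decomposition, if `z` is a sink. -/
def toDagDecomposition (T : CatchTree G z ∅ {z}ᶜ) (hz : ∀ v, ¬ G.Adj z v) :
    DagDecomposition G where
  -- The bottom `none` has bag `{z}` and lies below every node, which settles all edges into `z`;
  -- the bags of the tree do not contain `z`.
  Node := Option T.Node
  finite := by
    have := T.finite
    infer_instance
  dag := ⟨BottomArc T⟩
  acyclic := by
    intro x hx
    rcases x with _ | a
    · obtain ⟨y, hy, -⟩ := Relation.TransGen.head'_iff.1 hx
      exact BottomArc.not_none hy
    · obtain ⟨y, hay, hya⟩ := Relation.TransGen.head'_iff.1 hx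
      obtain ⟨b, rfl, hba⟩ := BottomArc.reach_of_some hya
      cases hay with
      | inner _ _ hab => exact T.acyclic a (Relation.TransGen.head' hab hba)
  bag o := o.elim {z} T.bag
  covers := by
    intro v
    by_cases hv : v = z
    · exact ⟨none, hv⟩
    · obtain ⟨j, hj⟩ := T.covers v hv
      exact ⟨some j, hj⟩
  connected := by
    intro i k j hik hkj
    rcases j with _ | j
    · rcases i with _ | i
      · rw [BottomArc.eq_none_of_reach hik]
        exact Set.inter_subset_left
      · rintro v ⟨hv, hvz⟩
        exact absurd hvz (by simpa using T.bag_subset i hv)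
    · obtain ⟨k, rfl, hkj'⟩ := BottomArc.reach_of_some hkj
      obtain ⟨i, rfl, hik'⟩ := BottomArc.reach_of_some hik
      exact T.connected i k j hik' hkj'
  source_edges := by
    intro j hj u hu v huv
    rcases j with _ | j
    · exact absurd (BottomArc.bottom T.root) (hj _)
    -- The only source is the root, and its bag is empty.
    · rcases Relation.ReflTransGen.cases_tail (T.reach j) with h | ⟨i, -, hij⟩
      · rw [h, Option.elim_some, T.bag_root] at hu
        exact hu.elim
      · exact absurd (BottomArc.inner i j hij) (hj _)
  arc_edges := by
    intro i j hij u hu v huv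
    cases hij with
    | bottom a =>
      obtain rfl : u = z := hu.1
      exact absurd huv (hz v)
    | inner a b hab =>
      rcases T.arc_edges a b hab u hu v huv with rfl | ⟨c, hbc, hc⟩
      · exact ⟨none, .single (.bottom b), rfl⟩
      · exact ⟨some c, BottomArc.reach_inner hbc, hc⟩

end CatchTree

theorem Catch.dagWidth_le {V : Type*} {G : Digraph V} {z : V} (h : Catch G z ∅ {z}ᶜ)
    (hz : ∀ v, ¬ G.Adj z v) : dagWidth G ≤ 3 := by
  obtain ⟨T⟩ := h.nonempty_catchTree (by simp) (Set.empty_disjoint _)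
  refine iInf_le_of_le (T.toDagDecomposition hz) (iSup_le ?_)
  rintro (_ | j)
  · change ({z} : Set V).encard ≤ 3
    simp
  · exact T.encard_le j
/-! ## Three cops suffice for structured programs -/

namespace Catch

variable {V : Type*} {G : Digraph V} {z : V} {X Y C C' : Set V}

theorem empty : Catch G z X ∅ := by
  simpa using Catch.split (G := G) (z := z) (X := X) (n := 0) (fun _ => ∅) nofun

theorem union (h : Catch G z X C) (h' : Catch G z X C') : Catch G z X (C ∪ C') := by
  have := Catch.split (n := 2) ![C, C'] (Fin.forall_fin_two.2 ⟨h, h'⟩)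
  rwa [show (⋃ i, ![C, C'] i) = C ∪ C' by ext; simp [Fin.exists_fin_two]] at this

end Catch

/-- With cops on `X`, control may be passed to `t` when the robber has nothing but `W` before him:
if the cops catch him in `U` by guarding `t`, then they also catch him in `U ∪ W`. -/
structure Safe {V : Type*} (G : Digraph V) (z : V) (X W : Set V) (t : V) : Prop where
  mem : t = z ∨ t ∈ X ∪ W
  -- `U` stands for whatever precedes `t` in the program. Quantifying over it lets statements be
  -- treated from the last to the first. The sink needs no cop, hence `\ {z}`.
  catch_union : ∀ U, Disjoint U W → Catch G z ({t} \ {z}) U → Catch G z X (U ∪ W)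

namespace Safe

variable {V : Type*} {G : Digraph V} {z : V} {X W W' : Set V} {t u : V}

theorem catch_territory (h : Safe G z X W t) : Catch G z X W := by
  simpa using h.catch_union ∅ (Set.empty_disjoint _) .empty

theorem mono (h : Safe G z X W t) (hW : W ⊆ W') (h' : Catch G z X W') : Safe G z X W' t where
  mem := h.mem.imp_right fun ht => Set.union_subset_union_right X hW ht
  catch_union U hU hc := by
    have := (h.catch_union U (hU.mono_right hW) hc).union h'
    rwa [Set.union_assoc, Set.union_eq_self_of_subset_left hW] at this

theorem sink (h : Catch G z X W) : Safe G z X W z where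
  mem := .inl rfl
  catch_union U _ hc := (hc.drop (by simp)).union h

theorem of_mem (ht : t = z ∨ t ∈ X) : Safe G z X ∅ t where
  mem := ht.imp_right .inl
  catch_union U _ hc := by
    rw [Set.union_empty]
    refine hc.drop ?_
    rintro v ⟨rfl, hv⟩
    exact ht.resolve_left hv

/-- A vertex that is passed at most once. -/
theorem insert_self (hX : X.encard ≤ 2) (hu : u ∉ W) (hW : Catch G z X W)
    (hadj : ∀ v, G.Adj u v → Safe G z X W v) : Safe G z X (insert u W) u where
  mem := .inr (.inr (.inl rfl))
  catch_union U hU hc := by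
    rw [Set.union_insert]
    rw [Set.disjoint_insert_right] at hU
    -- With a cop on `u`, a robber in `U` is handled by keeping only that cop, and a robber in `W`
    -- by lifting it again.
    refine .place u (fun h => h.elim hU.1 hu) hX (fun v hv => ?_)
      ((hc.drop (Set.sdiff_subset.trans (by simp))).union (hW.drop (Set.subset_insert u X)))
    exact (hadj v hv).mem.imp_right fun h =>
      .inr (h.imp_right .inr)

/-- A loop `insert u R` with exit `t` such that all cycles not inside nested loops pass through
`u`. -/
theorem loop {R : Set V} (ht : Safe G z X W t) (hu : u ∉ R) (hd : Disjoint (insert u R) W)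
    (hR : ∀ v ∈ R, Safe G z (insert u ({t} \ {z})) R v)
    (hadj : ∀ v, G.Adj u v → Safe G z (insert u ({t} \ {z})) R v)
    (hc : Catch G z (insert u ({t} \ {z})) R) :
    ∀ v ∈ insert u R, Safe G z X (W ∪ insert u R) v := by
  refine fun v hv => ⟨.inr (.inr (.inr hv)), fun U hU hcU => ?_⟩
  rw [Set.disjoint_union_right, Set.disjoint_insert_right] at hU
  -- Inside the loop, with cops on `u` and `t`: if the loop is entered at `u`, the cop there
  -- suffices for `U`; otherwise the entry `v` is safe within `R`.
  have key : Catch G z (insert u ({t} \ {z})) (U ∪ R) := by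
    rcases hv with rfl | hv
    · exact (hcU.drop (Set.sdiff_subset.trans (by simp))).union hc
    · exact (hR v hv).catch_union U hU.2.2 hcU
  have hcard : ({t} \ {z} : Set V).encard ≤ 2 :=
    (Set.encard_le_encard Set.sdiff_subset).trans (by simp)
  have := Catch.place u (fun h => h.elim hU.2.1 hu) hcard (fun v hv => by
    rcases (hadj v hv).mem with h | (h | h) | h
    · exact .inl h
    · exact .inr (.inl h)
    · exact .inr (.inr (.inl h))
    · exact .inr (.inr (.inr (.inr h)))) key
  rw [← Set.union_insert] at this
  -- From the exit `t`, the whole loop together with `U` counts as what precedes `t`.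
  have := ht.catch_union _ (Set.disjoint_union_left.2 ⟨hU.1, hd⟩) this
  rwa [Set.union_assoc, Set.union_comm _ W] at this

end Safe

/-- The vertex to which control is passed, when the vertices of a statement are embedded by `f` and
the symbolic successors are `o`, `x`, `e`, `z`. -/
def Target.elim {α : Type} {V : Type*} (f : α → V) (o x e z : V) : Target α → V
  | .vertex a => f a
  | .out => o
  | .exit => x
  | .entry => e
  | .halt => z

theorem Target.elim_resolve {α β : Type} {V : Type*} (g : α → β) (o' x' e' : Target β)
    (f : β → V) (o x e z : V) (τ : Target α) :
    (Target.resolve g o' x' e' τ).elim f o x e z =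
      τ.elim (f ∘ g) (o'.elim f o x e z) (x'.elim f o x e z) (e'.elim f o x e z) z := by
  cases τ <;> rfl

theorem Target.safe_elim {α : Type} {V : Type*} {G : Digraph V} {z : V} {X W : Set V} {f : α → V}
    {o x e : V} (hf : ∀ a, Safe G z X W (f a)) (ho : Safe G z X W o) (hx : Safe G z X W x)
    (he : Safe G z X W e) : ∀ τ : Target α, Safe G z X W (τ.elim f o x e z)
  | .vertex a => hf a
  | .out => ho
  | .exit => hx
  | .entry => he
  | .halt => .sink ho.catch_territory

theorem Target.safe_resolve {α β : Type} {V : Type*} {G : Digraph V} {z : V} {X W : Set V}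
    {g : α → β} {o' x' e' : Target β} {f : β → V} {o x e : V} {τ : Target α}
    (h : Safe G z X W
      (τ.elim (f ∘ g) (o'.elim f o x e z) (x'.elim f o x e z) (e'.elim f o x e z) z)) :
    Safe G z X W ((Target.resolve g o' x' e' τ).elim f o x e z) :=
  Target.elim_resolve g o' x' e' f o x e z τ ▸ h

namespace Stmt

variable {V : Type*} {G : Digraph V} {z : V}

/-- The statement `s` is embedded into the control-flow graph `G` by `f`, and its symbolic
successors are `o`, `x`, `e`, `z`. -/
def Embeds (G : Digraph V) (z : V) (s : Stmt) (f : s.Vertex → V) (o x e : V) : Prop :=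
  ∀ a v, G.Adj (f a) v → ∃ τ ∈ s.succs a, v = τ.elim f o x e z

theorem Embeds.of_image {s t : Stmt} {f : t.Vertex → V} {o x e : V} (h : Embeds G z t f o x e)
    (g : s.Vertex → t.Vertex) (o' x' e' : Target t.Vertex)
    (hg : ∀ a, t.succs (g a) ⊆ Target.resolve g o' x' e' '' s.succs a) :
    Embeds G z s (f ∘ g) (o'.elim f o x e z) (x'.elim f o x e z) (e'.elim f o x e z) := by
  intro a v hv
  obtain ⟨τ, hτ, rfl⟩ := h (g a) v hv
  obtain ⟨σ, hσ, rfl⟩ := hg a hτ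
  exact ⟨σ, hσ, Target.elim_resolve ..⟩

/-- If the symbolic successors of a statement are safe, so are its vertices. -/
theorem safe_elim (s : Stmt) : ∀ {f : s.Vertex → V} {o x e : V} {X W : Set V},
    Function.Injective f → Disjoint (Set.range f) W → X.encard ≤ 2 → Embeds G z s f o x e →
    Safe G z X W o → Safe G z X W x → Safe G z X W e →
    ∀ τ : Target s.Vertex, Safe G z X (W ∪ Set.range f) (τ.elim f o x e z) := by
  have none_case : ∀ (α : Type) [IsEmpty α] {f : α → V} {o x e : V} {X W : Set V},
      Safe G z X W o → Safe G z X W x → Safe G z X W e →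
      ∀ τ : Target α, Safe G z X (W ∪ Set.range f) (τ.elim f o x e z) := by
    intro α _ f o x e X W ho hx he
    rw [Set.range_eq_empty, Set.union_empty]
    exact Target.safe_elim isEmptyElim ho hx he
  induction s with
  | empty => intros; exact none_case Empty ‹_› ‹_› ‹_› _
  | brk => intros; exact none_case Empty ‹_› ‹_› ‹_› _
  | cont => intros; exact none_case Empty ‹_› ‹_› ‹_› _
  | ret => intros; exact none_case Empty ‹_› ‹_› ‹_› _
  | basic =>
    intro f o x e X W hf hd hX hE ho hx he
    have hr : Set.range f = {f ()} := by
      ext v; exact ⟨by rintro ⟨⟨⟩, rfl⟩; rfl, by rintro rfl; exact ⟨(), rfl⟩⟩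
    rw [hr, Set.union_singleton]
    rw [hr, Set.disjoint_singleton_left] at hd
    have hs : Safe G z X (insert (f ()) W) (f ()) := by
      refine .insert_self hX hd ho.catch_territory fun v hv => ?_
      obtain ⟨τ, hτ, rfl⟩ := hE () v hv
      rw [show τ = .out from hτ]
      exact ho
    have hm := fun {t : V} (h : Safe G z X W t) => h.mono (Set.subset_insert (f ()) W) hs.catch_territory
    exact Target.safe_elim (fun _ => hs) (hm ho) (hm hx) (hm he)
  | seq s t ihs iht =>
    intro f o x e X W hf hd hX hE ho hx he
    have hr : Set.range f = Set.range (f ∘ Sum.inl) ∪ Set.range (f ∘ Sum.inr) := by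
      ext v
      constructor
      · rintro ⟨a | b, rfl⟩
        exacts [.inl ⟨a, rfl⟩, .inr ⟨b, rfl⟩]
      · rintro (⟨a, rfl⟩ | ⟨b, rfl⟩) <;> exact ⟨_, rfl⟩
    rw [hr] at hd ⊢
    rw [Set.disjoint_union_left] at hd
    have ht := iht (hf.comp Sum.inr_injective) hd.2 hX
      (hE.of_image (s := t) Sum.inr .out .exit .entry fun a => subset_rfl) ho hx he
    have hm := fun {v : V} (h : Safe G z X W v) =>
      h.mono (W' := W ∪ Set.range (f ∘ Sum.inr)) Set.subset_union_left (ht .out).catch_territory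
    -- For `s`, the vertices of `t` belong to the territory ahead, and the entry of `t` is the
    -- successor.
    have hs := ihs (hf.comp Sum.inl_injective) (W := W ∪ Set.range (f ∘ Sum.inr))
      (Set.disjoint_union_right.2 ⟨hd.1, by
        rw [Set.disjoint_left]
        rintro _ ⟨a, rfl⟩ ⟨b, hb⟩
        cases hf hb⟩) hX
      (hE.of_image (s := s) Sum.inl (seqRight s t t.first) .exit .entry fun a => subset_rfl)
      (Target.safe_resolve (ht _)) (hm hx) (hm he)
    rw [Set.union_assoc, Set.union_comm (Set.range (f ∘ Sum.inr))] at hs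
    have hm' := fun {v : V} (h : Safe G z X (W ∪ Set.range (f ∘ Sum.inr)) v) =>
      h.mono (Set.union_subset_union_right W Set.subset_union_right) (hs .out).catch_territory
    exact Target.safe_elim (Sum.rec (fun a => hs (.vertex a)) fun b => hm' (ht (.vertex b)))
      (hm' (hm ho)) (hm' (hm hx)) (hm' (hm he))
  | branch n alt ih =>
    intro f o x e X W hf hd hX hE ho hx he
    let g (i : Fin (n + 1)) : (alt i).Vertex → (Stmt.branch n alt).Vertex := fun a => some ⟨i, a⟩
    have hg : ∀ i, Function.Injective (g i) := by
      intro i a b hab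
      cases hab
      rfl
    have hi := fun i => ih i (hf.comp (hg i))
      (hd.mono_left (Set.range_comp_subset_range (g i) f)) hX
      (hE.of_image (s := alt i) (g i) .out .exit .entry fun a => subset_rfl) ho hx he
    let R := ⋃ i, (W ∪ Set.range (f ∘ g i))
    have hcR : Catch G z X R := .split _ fun i => (hi i .out).catch_territory
    have hiR := fun i τ => (hi i τ).mono
      (Set.subset_iUnion (fun i => W ∪ Set.range (f ∘ g i)) i) hcR
    -- There is at least one alternative, so index `0` is available.
    have hWR : W ⊆ R := Set.subset_union_left.trans 
      (Set.subset_iUnion (fun i => W ∪ Set.range (f ∘ g i)) 0)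
    have hr : W ∪ Set.range f = insert (f none) R := by
      ext v
      constructor
      · rintro (hv | ⟨_ | ⟨i, a⟩, rfl⟩)
        · exact .inr (hWR hv)
        · exact .inl rfl
        · exact .inr (Set.mem_iUnion.2 ⟨i, .inr ⟨a, rfl⟩⟩)
      · rintro (rfl | hv)
        · exact .inr ⟨none, rfl⟩
        · obtain ⟨i, hv | ⟨a, rfl⟩⟩ := Set.mem_iUnion.1 hv
          · exact .inl hv
          · exact .inr ⟨_, rfl⟩
    rw [hr]
    have hn : f none ∉ R := by
      intro hv
      obtain ⟨i, hv | ⟨a, ha⟩⟩ := Set.mem_iUnion.1 hv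
      · exact Set.disjoint_left.1 hd ⟨none, rfl⟩ hv
      · cases hf ha
    have hs : Safe G z X (insert (f none) R) (f none) := by
      refine .insert_self hX hn hcR fun v hv => ?_
      obtain ⟨τ, ⟨i, rfl⟩, rfl⟩ := hE none v hv
      exact Target.safe_resolve (hiR i _)
    have hm := fun {v : V} (h : Safe G z X R v) =>
      h.mono (Set.subset_insert (f none) R) hs.catch_territory
    refine Target.safe_elim ?_ (hm (ho.mono hWR hcR)) (hm (hx.mono hWR hcR))
      (hm (he.mono hWR hcR))
    rintro (_ | ⟨i, a⟩)
    · exact hs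
    · exact hm (hiR i (.vertex a))
  | loop test body step ihb ihs =>
    intro f o x e X W hf hd hX hE ho hx he
    -- The two cops that hold the loop: one on its head, one on its exit point unless that is the
    -- sink. With them in place, all successors of `step` are safe with no territory ahead.
    let Y : Set V := insert (f none) ({o} \ {z})
    have hY : Y.encard ≤ 2 := (Set.encard_insert_le _ _).trans <| by
      calc ({o} \ {z} : Set V).encard + 1 ≤ 1 + 1 := by
            gcongr
            exact (Set.encard_le_encard Set.sdiff_subset).trans (by simp)
        _ = 2 := by norm_num
    have hoY : Safe G z Y ∅ o := .of_mem <| by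
      by_cases h : o = z
      · exact .inl h
      · exact .inr (.inr ⟨rfl, h⟩)
    have hnY : Safe G z Y ∅ (f none) := .of_mem (.inr (.inl rfl))
    let gb : body.Vertex → (Stmt.loop test body step).Vertex := fun a => some (.inl a)
    let gs : step.Vertex → (Stmt.loop test body step).Vertex := fun a => some (.inr a)
    have hgb : Function.Injective gb := (Option.some_injective _).comp Sum.inl_injective
    have hgs : Function.Injective gs := (Option.some_injective _).comp Sum.inr_injective
    have hs := ihs (hf.comp hgs) (Set.disjoint_empty _) hY
      (hE.of_image (s := step) gs (.vertex none) .out (.vertex none) fun a => subset_rfl)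
      hnY hoY hnY
    rw [Set.empty_union] at hs
    have hfirst : Safe G z Y (Set.range (f ∘ gs))
        ((inLoopStep test body step step.first).elim f o x e z) :=
      Target.safe_resolve (hs _)
    -- Both the end of `body` and `continue` lead to `step`, so the vertices of `step` are the
    -- territory ahead.
    have hb := ihb (hf.comp hgb) (W := Set.range (f ∘ gs)) (by
        rw [Set.disjoint_left]
        rintro _ ⟨a, rfl⟩ ⟨b, hb⟩
        cases hf hb) hY
      (hE.of_image (s := body) gb (inLoopStep test body step step.first) .out
        (inLoopStep test body step step.first) fun a => subset_rfl) hfirst (hs .exit) hfirst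
    have hr : Set.range f = insert (f none) (Set.range (f ∘ gs) ∪ Set.range (f ∘ gb)) := by
      ext v
      constructor
      · rintro ⟨_ | a | b, rfl⟩
        · exact .inl rfl
        · exact .inr (.inr ⟨a, rfl⟩)
        · exact .inr (.inl ⟨b, rfl⟩)
      · rintro (rfl | ⟨a, rfl⟩ | ⟨a, rfl⟩) <;> exact ⟨_, rfl⟩
    have hn : f none ∉ Set.range (f ∘ gs) ∪ Set.range (f ∘ gb) := by
      rintro (⟨a, ha⟩ | ⟨a, ha⟩) <;> cases hf ha
    have hv : ∀ v ∈ Set.range f, Safe G z X (W ∪ Set.range f) v := by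
      rw [hr] at hd ⊢
      refine ho.loop hn hd ?_ (fun v hv => ?_) (hb .out).catch_territory
      · rintro _ (⟨a, rfl⟩ | ⟨a, rfl⟩)
        · exact (hs (.vertex a)).mono Set.subset_union_left (hb .out).catch_territory
        · exact hb (.vertex a)
      · obtain ⟨τ, rfl | ⟨-, rfl⟩, rfl⟩ := hE none v hv
        · exact Target.safe_resolve (hb _)
        · exact hb .exit
    have hm := fun {v : V} (h : Safe G z X W v) =>
      h.mono (W' := W ∪ Set.range f) Set.subset_union_left (hv _ ⟨none, rfl⟩).catch_territory
    exact Target.safe_elim (fun a => hv _ ⟨a, rfl⟩) (hm ho) (hm hx) (hm he)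
  | doWhile body ihb =>
    intro f o x e X W hf hd hX hE ho hx he
    let Y : Set V := insert (f none) ({o} \ {z})
    have hY : Y.encard ≤ 2 := (Set.encard_insert_le _ _).trans <| by
      calc ({o} \ {z} : Set V).encard + 1 ≤ 1 + 1 := by
            gcongr
            exact (Set.encard_le_encard Set.sdiff_subset).trans (by simp)
        _ = 2 := by norm_num
    have hoY : Safe G z Y ∅ o := .of_mem <| by
      by_cases h : o = z
      · exact .inl h
      · exact .inr (.inr ⟨rfl, h⟩)
    have hnY : Safe G z Y ∅ (f none) := .of_mem (.inr (.inl rfl))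
    let gb : body.Vertex → (Stmt.doWhile body).Vertex := some
    have hb := ihb (hf.comp (Option.some_injective _ : Function.Injective gb))
      (Set.disjoint_empty _) hY
      (hE.of_image (s := body) gb (.vertex none) .out (.vertex none) fun a => subset_rfl)
      hnY hoY hnY
    rw [Set.empty_union] at hb
    have hr : Set.range f = insert (f none) (Set.range (f ∘ gb)) := by
      ext v
      constructor
      · rintro ⟨_ | a, rfl⟩
        · exact .inl rfl
        · exact .inr ⟨a, rfl⟩
      · rintro (rfl | ⟨a, rfl⟩) <;> exact ⟨_, rfl⟩
    have hn : f none ∉ Set.range (f ∘ gb) := by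
      rintro ⟨a, ha⟩
      cases hf ha
    have hv : ∀ v ∈ Set.range f, Safe G z X (W ∪ Set.range f) v := by
      rw [hr] at hd ⊢
      refine ho.loop hn hd ?_ (fun v hv => ?_) (hb .out).catch_territory
      · rintro _ ⟨a, rfl⟩
        exact hb (.vertex a)
      · obtain ⟨τ, rfl | rfl, rfl⟩ := hE none v hv
        · exact Target.safe_resolve (hb _)
        · exact hb .exit
    have hm := fun {v : V} (h : Safe G z X W v) =>
      h.mono (W' := W ∪ Set.range f) Set.subset_union_left (hv _ ⟨none, rfl⟩).catch_territory
    exact Target.safe_elim (fun a => hv _ ⟨a, rfl⟩) (hm ho) (hm hx) (hm he)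
  | switch hasDefault body ihb =>
    intro f o x e X W hf hd hX hE ho hx he
    let gb : body.Vertex → (Stmt.switch hasDefault body).Vertex := some
    -- A switch adds no cycle and needs no cop of its own; `break` acts like reaching the end, so
    -- `o` replaces `x`.
    have hb := ihb (hf.comp (Option.some_injective _ : Function.Injective gb))
      (hd.mono_left (Set.range_comp_subset_range gb f)) hX
      (hE.of_image (s := body) gb .out .out .entry fun a => subset_rfl) ho ho he
    have hr : W ∪ Set.range f = insert (f none) (W ∪ Set.range (f ∘ gb)) := by
      ext v
      constructor
      · rintro (hv | ⟨_ | a, rfl⟩)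
        · exact .inr (.inl hv)
        · exact .inl rfl
        · exact .inr (.inr ⟨a, rfl⟩)
      · rintro (rfl | hv | ⟨a, rfl⟩)
        · exact .inr ⟨none, rfl⟩
        · exact .inl hv
        · exact .inr ⟨_, rfl⟩
    rw [hr]
    have hn : f none ∉ W ∪ Set.range (f ∘ gb) := by
      rintro (hv | ⟨a, ha⟩)
      · exact Set.disjoint_left.1 hd ⟨none, rfl⟩ hv
      · cases hf ha
    have hs : Safe G z X (insert (f none) (W ∪ Set.range (f ∘ gb))) (f none) := by
      refine .insert_self hX hn (hb .out).catch_territory fun v hv => ?_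
      -- Which statements carry labels does not matter: every target in the body is safe.
      obtain ⟨τ, ⟨τ, -, rfl⟩ | ⟨-, rfl⟩, rfl⟩ := hE none v hv
      · exact Target.safe_resolve (hb _)
      · exact hb .out
    have hm := fun {v : V} (h : Safe G z X (W ∪ Set.range (f ∘ gb)) v) =>
      h.mono (Set.subset_insert (f none) _) hs.catch_territory
    have hx' := hx.mono (W' := W ∪ Set.range (f ∘ gb)) Set.subset_union_left (hb .out).catch_territory
    refine Target.safe_elim ?_ (hm (hb .out)) (hm hx') (hm (hb .entry))
    rintro (_ | a)
    · exact hs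
    · exact hm (hb (.vertex a))
  | caseLabel s ih => exact fun hf hd hX hE ho hx he τ => ih hf hd hX hE ho hx he τ

end Stmt

theorem dagWidth_controlFlowGraph_le (p : Stmt) : dagWidth (controlFlowGraph p) ≤ 3 := by
  refine Catch.dagWidth_le (z := CfgVertex.halt) ?_ fun v h => h
  -- At the top level there are no cops yet, and all symbolic successors are the sink.
  have hz : Safe (controlFlowGraph p) .halt ∅ ∅ .halt := .sink .empty
  have helim : ∀ τ : Target p.Vertex, CfgVertex.ofTarget τ =
      τ.elim CfgVertex.node .halt .halt .halt .halt := by rintro (_ | _ | _ | _ | _) <;> rfl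
  have hp := p.safe_elim (G := controlFlowGraph p) (z := .halt) (f := CfgVertex.node)
    (fun a b h => by cases h; rfl) (Set.disjoint_empty _) (by simp)
    (fun a v h => by
      obtain ⟨τ, hτ, rfl⟩ := h
      exact ⟨τ, hτ, helim τ⟩) hz hz hz
  rw [Set.empty_union] at hp
  have hs : Safe (controlFlowGraph p) .halt ∅ (insert .start (Set.range CfgVertex.node)) .start := by
    refine .insert_self (by simp) (by simp) (hp .out).catch_territory fun v hv => ?_
    rw [show v = CfgVertex.ofTarget p.first from hv, helim]
    exact hp _
  convert hs.catch_territory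
  ext v
  rcases v with _ | a | _ <;> simp
/-! ## Two cops do not suffice -/

theorem Set.exists_subset_pair_of_encard_lt_three {α : Type*} [Nonempty α] {s : Set α}
    (hs : s.encard < 3) : ∃ a b, s ⊆ {a, b} := by
  obtain rfl | ⟨a, ha⟩ := s.eq_empty_or_nonempty
  · exact ⟨Classical.arbitrary α, Classical.arbitrary α, Set.empty_subset _⟩
  · have h1 : (s \ {a}).encard ≤ 1 := by
      have := Set.encard_sdiff_singleton_add_one ha
      rw [← this, show (3 : ℕ∞) = 2 + 1 by norm_num] at hs
      have := lt_of_add_lt_add_right hs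
      exact Order.le_of_lt_add_one (by simpa [one_add_one_eq_two] using this)
    rw [Set.encard_le_one_iff] at h1
    by_cases hb : ∃ b, b ∈ s \ {a}
    · obtain ⟨b, hb⟩ := hb
      refine ⟨a, b, fun c hc => ?_⟩
      by_cases hca : c = a
      · exact .inl hca
      · exact .inr (h1 c b ⟨hc, hca⟩ hb)
    · push Not at hb
      refine ⟨a, a, fun c hc => ?_⟩
      by_contra hca
      exact hb c ⟨hc, fun h => hca (by simp [Set.mem_singleton_iff.1 h])⟩

/-! ### Following a robber down a DAG decomposition -/

namespace DagDecomposition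

variable {V : Type*} {G : Digraph V} (d : DagDecomposition G)

/-- The vertices in the bags below a node. -/
def below (j : d.Node) : Set V := {v | ∃ k, Relation.ReflTransGen d.dag.Adj j k ∧ v ∈ d.bag k}

variable {d} {i j : d.Node} {u v : V}

theorem below_subset (h : Relation.ReflTransGen d.dag.Adj j i) : d.below i ⊆ d.below j :=
  fun _ ⟨k, hk, hv⟩ => ⟨k, h.trans hk, hv⟩

/-- Going back from a bag containing `u` towards `j`, some arc leads from a bag without `u` to one
with `u`; condition (3b) applies to that arc. -/
theorem adj_mem_below (hu : u ∈ d.below j) (huj : u ∉ d.bag j) (huv : G.Adj u v) :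
    v ∈ d.below j := by
  obtain ⟨k, hjk, huk⟩ := hu
  induction hjk with
  | refl => exact absurd huk huj
  | @tail b c hjb hbc ih =>
    by_cases hub : u ∈ d.bag b
    · exact ih hub
    · exact below_subset (hjb.tail hbc) (d.arc_edges b c hbc u ⟨huk, hub⟩ v huv)

/-- When the cops move from the bag of `j` to that of `i`, those on the common vertices stay. A
robber avoiding these vertices cannot leave the region below `i`. -/
theorem mem_below_of_reach {r s : V} (hji : d.dag.Adj j i)
    (h : Relation.ReflTransGen (fun a b => G.Adj a b ∧ a ∉ d.bag j ∩ d.bag i) r s)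
    (hr : r ∈ d.below i) : s ∈ d.below i := by
  induction h with
  | refl => exact hr
  | @tail b c _ hbc ih =>
    by_cases hb : b ∈ d.bag i
    · exact d.arc_edges j i hji b ⟨hb, fun h => hbc.2 ⟨h, hb⟩⟩ c hbc.1
    · exact adj_mem_below ih hb hbc.1

theorem adj_mem_below_of_source (hj : ∀ i, ¬ d.dag.Adj i j) (hu : u ∈ d.below j)
    (huv : G.Adj u v) : v ∈ d.below j := by
  by_cases huj : u ∈ d.bag j
  · exact d.source_edges j hj u huj v huv
  · exact adj_mem_below hu huj huv

variable (d) in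
theorem wellFounded_flip_adj : WellFounded fun i j => d.dag.Adj j i := by
  have := d.finite
  have : Std.Irrefl (Relation.TransGen fun i j => d.dag.Adj j i) :=
    ⟨fun i hi => d.acyclic i (Relation.transGen_swap.1 hi)⟩
  exact Subrelation.wf (r := Relation.TransGen fun i j => d.dag.Adj j i)
    (fun h => Relation.TransGen.single h) (Finite.wellFounded_of_trans_of_irrefl _)

variable (d) in
theorem exists_source (k : d.Node) :
    ∃ j, (∀ i, ¬ d.dag.Adj i j) ∧ Relation.ReflTransGen d.dag.Adj j k := by
  have := d.finite
  have : Std.Irrefl (Relation.TransGen d.dag.Adj) := ⟨d.acyclic⟩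
  induction k using (Finite.wellFounded_of_trans_of_irrefl
    (Relation.TransGen d.dag.Adj)).induction with
  | _ k ih =>
    by_cases h : ∃ i, d.dag.Adj i k
    · obtain ⟨i, hik⟩ := h
      obtain ⟨j, hj, hji⟩ := ih i (.single hik)
      exact ⟨j, hj, hji.tail hik⟩
    · exact ⟨k, fun i hi => h ⟨i, hi⟩, .refl⟩

theorem exists_arc_mem_below (hu : u ∈ d.below j) (huj : u ∉ d.bag j) :
    ∃ i, d.dag.Adj j i ∧ u ∈ d.below i := by
  obtain ⟨k, hjk, huk⟩ := hu
  rcases Relation.ReflTransGen.cases_head hjk with rfl | ⟨i, hji, hik⟩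
  · exact absurd huk huj
  · exact ⟨i, hji, k, hik, huk⟩

end DagDecomposition

/-- If a robber evades two cops who move one at a time, then the DAG-width is at least three. The
vertices in `B a` are those where the robber is safe while a cop stays on `a`. -/
theorem three_le_dagWidth_of_evasion {V I : Type*} {G : Digraph V} {g : I → V}
    (hg : Function.Injective g) {B : I → Set I} (hB : ∀ a, a ∉ B a) (hne : ∃ a, (B a).Nonempty)
    (hmove : ∀ a c, ∀ r ∈ B a, ∃ s ∈ B a ∩ B c,
      Relation.ReflTransGen (fun u v => G.Adj (g u) (g v) ∧ u ≠ a) r s) :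
    3 ≤ dagWidth G := by
  obtain ⟨x, r₀, hr₀⟩ := hne
  have : Nonempty I := ⟨x⟩
  refine le_iInf fun d => ?_
  by_contra! hw
  have := d.finite
  -- Only the cops on the range of `g` matter, and there are at most two of them, possibly equal.
  have hpair : ∀ j, ∃ a b, g ⁻¹' d.bag j ⊆ {a, b} := fun j =>
    Set.exists_subset_pair_of_encard_lt_three <|
      (hg.encard_image (g ⁻¹' d.bag j) ▸ Set.encard_le_encard (Set.image_preimage_subset g _) :
        (g ⁻¹' d.bag j).encard ≤ (d.bag j).encard).trans_lt
      ((le_iSup (fun i => (d.bag i).encard) j).trans_lt hw)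
  choose a b hab using hpair
  have hout : ∀ j, ∀ r ∈ B (a j) ∩ B (b j), g r ∉ d.bag j := by
    rintro j r ⟨ha, hb⟩ hr
    rcases hab j hr with rfl | rfl
    exacts [hB _ ha, hB _ hb]
  have hmove' : ∀ (c e : I) (S : Set V), (∀ u, g u ∈ S → u = c) → ∀ r ∈ B c, ∃ s ∈ B c ∩ B e,
      Relation.ReflTransGen (fun u v => G.Adj u v ∧ u ∉ S) (g r) (g s) := by
    intro c e S hS r hr
    obtain ⟨s, hs, h⟩ := hmove c e r hr
    exact ⟨s, hs, h.lift g fun u v huv => ⟨huv.1, fun hu => huv.2 (hS u hu)⟩⟩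
  have hmove₂ : ∀ (c e f : I) (S : Set V), (∀ u, g u ∉ S) → ∀ r ∈ B c, ∃ s ∈ B e ∩ B f,
      Relation.ReflTransGen (fun u v => G.Adj u v ∧ u ∉ S) (g r) (g s) := by
    intro c e f S hS r hr
    obtain ⟨s, hs, h⟩ := hmove' c e S (fun u hu => absurd hu (hS u)) r hr
    obtain ⟨t, ht, h'⟩ := hmove' e f S (fun u hu => absurd hu (hS u)) s hs.2
    exact ⟨t, ht, h.trans h'⟩
  -- If the two pairs share one cop, that cop stays and one move suffices. If they share none, no
  -- vertex in the range of `g` is blocked and two moves are made.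
  have step : ∀ i j, ∀ r ∈ B (a j) ∩ B (b j), ∃ s ∈ B (a i) ∩ B (b i),
      Relation.ReflTransGen (fun u v => G.Adj u v ∧ u ∉ d.bag j ∩ d.bag i) (g r) (g s) := by
    rintro i j r ⟨hra, hrb⟩
    have hS : ∀ u, g u ∈ d.bag j ∩ d.bag i → (u = a j ∨ u = b j) ∧ (u = a i ∨ u = b i) :=
      fun u hu => ⟨hab j hu.1, hab i hu.2⟩
    by_cases h₁ : a j = a i
    · by_cases h₂ : b j = b i
      · exact ⟨r, ⟨h₁ ▸ hra, h₂ ▸ hrb⟩, .refl⟩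
      · obtain ⟨s, hs, h⟩ := hmove' (a j) (b i) _ (fun u hu => by have := hS u hu; grind only) r hra
        exact ⟨s, h₁ ▸ hs, h⟩
    by_cases h₂ : a j = b i
    · by_cases h₃ : b j = a i
      · exact ⟨r, ⟨h₃ ▸ hrb, h₂ ▸ hra⟩, .refl⟩
      · obtain ⟨s, hs, h⟩ := hmove' (a j) (a i) _ (fun u hu => by have := hS u hu; grind only) r hra
        exact ⟨s, ⟨hs.2, h₂ ▸ hs.1⟩, h⟩
    by_cases h₃ : b j = a i
    · obtain ⟨s, hs, h⟩ := hmove' (b j) (b i) _ (fun u hu => by have := hS u hu; grind only) r hrb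
      exact ⟨s, h₃ ▸ hs, h⟩
    by_cases h₄ : b j = b i
    · obtain ⟨s, hs, h⟩ := hmove' (b j) (a i) _ (fun u hu => by have := hS u hu; grind only) r hrb
      exact ⟨s, ⟨hs.2, h₄ ▸ hs.1⟩, h⟩
    exact hmove₂ (a j) (a i) (b i) _ (fun u hu => by have := hS u hu; grind only) r hra
  -- Induction from the bottom of the DAG upwards: a safe robber below `j` would become a safe
  -- robber below some child of `j`.
  have key : ∀ j, ∀ r ∈ B (a j) ∩ B (b j), g r ∉ d.below j := by
    intro j
    induction j using d.wellFounded_flip_adj.induction with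
    | _ j ih =>
      intro r hr hrj
      obtain ⟨i, hji, hri⟩ := DagDecomposition.exists_arc_mem_below hrj (hout j r hr)
      obtain ⟨s, hs, hrs⟩ := step i j r hr
      exact ih i hji s hs (DagDecomposition.mem_below_of_reach hji hrs hri)
  obtain ⟨k, hk⟩ := d.covers (g r₀)
  obtain ⟨j, hj, hjk⟩ := d.exists_source k
  -- The region below a source is closed under edges, so the robber can reach a safe vertex for `j`
  -- without leaving it.
  obtain ⟨s, hs, h⟩ := hmove₂ x (a j) (b j) ∅ (fun _ => id) r₀ hr₀
  refine key j s hs ?_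
  have hr₀j : g r₀ ∈ d.below j := ⟨k, hjk, hk⟩
  exact h.rec hr₀j fun _ h ih => DagDecomposition.adj_mem_below_of_source hj ih h.1

/-! ### A program that two cops cannot handle -/

/-- `while { while { if break }; while { if break } }` -/
def twoLoopsInLoop : Stmt :=
  .loop true (.seq (.loop true (.branch 1 ![.brk, .empty]) .empty)
    (.loop true (.branch 1 ![.brk, .empty]) .empty)) .empty

/-- The vertices of `twoLoopsInLoop` in the order of the text. -/
def twoLoopsInLoopVertex : Fin 5 → twoLoopsInLoop.Vertex :=
  ![none, some (.inl (.inl none)), some (.inl (.inl (some (.inl none)))),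
    some (.inl (.inr none)), some (.inl (.inr (some (.inl none))))]

theorem twoLoopsInLoopVertex_injective : Function.Injective twoLoopsInLoopVertex := by
  intro i j h
  fin_cases i <;> fin_cases j <;> first | rfl | cases h

/-- Edges of the control-flow graph between these vertices. -/
def twoLoopsInLoopEdges : List (Fin 5 × Fin 5) :=
  [(0, 1), (1, 2), (1, 3), (2, 1), (2, 3), (3, 0), (3, 4), (4, 0), (4, 3)]

theorem twoLoopsInLoop_adj (i j : Fin 5)
    (h : (i, j) ∈ twoLoopsInLoopEdges) :
    (controlFlowGraph twoLoopsInLoop).Adj (.node (twoLoopsInLoopVertex i))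
      (.node (twoLoopsInLoopVertex j)) := by
  simp only [twoLoopsInLoopEdges, List.mem_cons, Prod.mk.injEq, List.not_mem_nil, or_false] at h
  rcases h with ⟨rfl, rfl⟩ | ⟨rfl, rfl⟩ | ⟨rfl, rfl⟩ | ⟨rfl, rfl⟩ | ⟨rfl, rfl⟩ | ⟨rfl, rfl⟩ |
    ⟨rfl, rfl⟩ | ⟨rfl, rfl⟩ | ⟨rfl, rfl⟩
  · exact ⟨_, .inl rfl, rfl⟩
  · exact ⟨_, ⟨_, ⟨_, .inl rfl, rfl⟩, rfl⟩, rfl⟩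
  · exact ⟨_, ⟨_, ⟨_, .inr ⟨rfl, rfl⟩, rfl⟩, rfl⟩, rfl⟩
  · exact ⟨_, ⟨_, ⟨_, ⟨_, ⟨1, rfl⟩, rfl⟩, rfl⟩, rfl⟩, rfl⟩
  · exact ⟨_, ⟨_, ⟨_, ⟨_, ⟨0, rfl⟩, rfl⟩, rfl⟩, rfl⟩, rfl⟩
  · exact ⟨_, ⟨_, ⟨_, .inr ⟨rfl, rfl⟩, rfl⟩, rfl⟩, rfl⟩
  · exact ⟨_, ⟨_, ⟨_, .inl rfl, rfl⟩, rfl⟩, rfl⟩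
  · exact ⟨_, ⟨_, ⟨_, ⟨_, ⟨0, rfl⟩, rfl⟩, rfl⟩, rfl⟩, rfl⟩
  · exact ⟨_, ⟨_, ⟨_, ⟨_, ⟨1, rfl⟩, rfl⟩, rfl⟩, rfl⟩, rfl⟩

theorem exists_three_le_dagWidth : ∃ p : Stmt, 3 ≤ dagWidth (controlFlowGraph p) := by
  refine ⟨twoLoopsInLoop, three_le_dagWidth_of_evasion
    (g := fun i => CfgVertex.node (twoLoopsInLoopVertex i))
    (fun i j h => twoLoopsInLoopVertex_injective (CfgVertex.node.inj h))
    -- The only listed edge out of `0` goes to `1`. So while a cop stays on `1`, the vertex `0` is a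
    -- trap and has to be excluded.
    (B := fun a => {r | r ≠ a ∧ (a = 1 → r ≠ 0)}) (fun a h => h.1 rfl) ⟨0, 1, by simp⟩ ?_⟩
  -- At most two edges are needed each time; `0 → 1 → 2`, with a cop on `3` and another coming to
  -- `1`, needs both.
  have hE : ∀ a c r : Fin 5, (r ≠ a ∧ (a = 1 → r ≠ 0)) →
      ∃ s t : Fin 5, ((t ≠ a ∧ (a = 1 → t ≠ 0)) ∧ (t ≠ c ∧ (c = 1 → t ≠ 0))) ∧
        (r = s ∨ (r, s) ∈ twoLoopsInLoopEdges ∧ r ≠ a) ∧ (s = t ∨ (s, t) ∈ twoLoopsInLoopEdges ∧ s ≠ a) := by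
    set_option synthInstance.maxSize 1000 in
    set_option synthInstance.maxHeartbeats 200000 in
    decide
  intro a c r hr
  obtain ⟨s, t, ht, hrs, hst⟩ := hE a c r hr
  have hs := fun u v (h : u = v ∨ (u, v) ∈ twoLoopsInLoopEdges ∧ u ≠ a) =>
    (Relation.reflTransGen_iff_eq_or_transGen).2 (h.imp Eq.symm fun h =>
      Relation.TransGen.single (r := fun u v =>
        (controlFlowGraph twoLoopsInLoop).Adj (.node (twoLoopsInLoopVertex u))
          (.node (twoLoopsInLoopVertex v)) ∧ u ≠ a) ⟨twoLoopsInLoop_adj u v h.1, h.2⟩)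
  exact ⟨t, ht, (hs r s hrs).trans (hs s t hst)⟩

theorem mainTheorem1 :
    (∀ p : Stmt, dagWidth (controlFlowGraph p) ≤ 3) ∧
      ∃ p : Stmt, 3 ≤ dagWidth (controlFlowGraph p) :=
  ⟨dagWidth_controlFlowGraph_le, exists_three_le_dagWidth⟩
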